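/- Let $1\le n<p$ and let $X\in\mathbb{R}^{n\times p}$ be such that every $n$ columns of $X$ are linearly independent. Let $w_1,\dots,w_p>0$, $W=\mathrm{diag}(w_i)$, $\lambda>0$, $\sigma>0$, $\mu_0\in\mathbb{R}^n$ and $y\sim\mathcal N_n(\mu_0,\sigma^2 I_n)$. Assume that for every $v\in\mathbb{R}^n$ the lasso problem $$\min_{\beta\in\mathbb{R}^p}\ \frac1{2n}\|v-X\beta\|_2^2+\lambda\sum_{i=1}^p w_i|\beta_i|$$ has a unique solution $\hat\beta(v)$, and write $\hat\beta=\hat\beta(y)$, $\mathcal A=\{i:\hat\beta_i\neq0\}$, $\mathcal I=\{1,\dots,p\}\setminus\mathcal A$. Put $\Psi=X^{\mathsf T}X/n$ and let $S\in\mathbb{R}^p$ be given by the KKT equation $\frac1nX^{\mathsf T}y=\Psi\hat\beta+\lambda WS$; it is a subgradient of the $\ell_1$ norm at $\hat\beta$. Let $V=[V_R\,|\,V_N]$ be an orthogonal $p\times p$ matrix whose first $n$ columns $V_R$ are eigenvectors of $\Psi$ for its positive eigenvalues $\Lambda_1,\dots,\Lambda_n$ and whose last $p-n$ columns $V_N$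 form a basis of the null space of $X$; for a set $A$ of indices, $V_{AR}, V_{AN}$ denote the rows of $V_R,V_N$ in $A$, and $\Psi_A$ the columns of $\Psi$ in $A$. For $A\subseteq\{1,\dots,p\}$ with complement $I$ and $\theta=(b_A,s_I)\in\mathbb{R}^A\times\mathbb{R}^I$, let $b\in\mathbb{R}^p$ extend $b_A$ by $0$, let $s\in\mathbb{R}^p$ have the parts $s_A=\mathrm{sgn}(b_A)$ and $s_I$, and put $H(\theta,A;\mu_0,\lambda)=\Psi b+\lambda Ws-\frac1nX^{\mathsf T}\mu_0$. Call $(\theta,A)$ feasible if all entries of $b_A$ are nonzero and $$V_{AN}^{\mathsf T}W_{AA}\,\mathrm{sgn}(b_A)+V_{IN}^{\mathsf T}W_{II}\,s_I=0,\qquad \|s_I\|_\infty\le1 .$$ For every $A$ with $|A|\le n$ let $B(I)\in\mathbb{R}^{|I|\times(n-|A|)}$ be a matrix whose columns form a basis (for example an orthonormal one) of the null space of $V_{IN}^{\mathsf T}W_{II}$, and parametrize the solutions $s_I$ of the equality constraint, for each sign vector $s_A=\mathrm{sgn}(b_A)\in\{-1,1\}^A$, as $s_I=s^0_I(s_A)+B(I)s_F$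 with $s_F\in\mathbb{R}^{n-|A|}$ and $s^0_I(s_A)$ any particular solution. Let $d\theta=db_A\,ds_F$ be Lebesgue measure in the coordinates $(b_A,s_F)\in\mathbb{R}^n$. Let $T(A;\lambda)=[\,V_R^{\mathsf T}\Psi_A\,|\,\lambda V_{IR}^{\mathsf T}W_{II}B(I)\,]\in\mathbb{R}^{n\times n}$, and let $f_R(\cdot;\sigma^2)$ be the density of $\mathcal N_n(0,\sigma^2\,\mathrm{diag}(\Lambda_1,\dots,\Lambda_n)/n)$. Let $F$ be a map defined on the pairs $(\theta,A)$ and $\mathcal E$ a set such that $\{F\in\mathcal E\}$ is measurable and $\mathbb P\{F(\hat\beta_{\mathcal A},S_{\mathcal I},\mathcal A)\in\mathcal E\}>0$. Then the conditional distribution of $(\hat\beta_{\mathcal A},S_{\mathcal I},\mathcal A)$ given $F(\hat\beta_{\mathcal A},S_{\mathcal I},\mathcal A)\in\mathcal E$ is concentrated on the feasible $(\theta,A)$ with $|A|\le n$ and is given there by $$\mathbb P_{\Theta,\mathcal A\mid F\in\mathcal E}(d\theta,A)=\frac1Z\,f_R\big(V_R^{\mathsf T}H(\theta,A;\mu_0,\lambda);\sigma^2\big)\,|\det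 T(A;\lambda)|\,\mathbf 1_{\mathcal E}(F(\theta,A))\,d\theta ,$$ where the normalizing constant $Z\in(0,\infty)$ is the sum over $A$ with $|A|\le n$ of the integrals of the unnormalized density over the feasible $\theta$. -/

import Mathlib

open MeasureTheory ProbabilityTheory Matrix
open scoped ENNReal

noncomputable section

namespace LassoEA

/-- The lasso criterion `(1/(2n)) ‖y - Xβ‖₂² + λ ∑ᵢ wᵢ |βᵢ|`. -/
def objective {n p : ℕ} (X : Matrix (Fin n) (Fin p) ℝ) (w : Fin p → ℝ) (lam : ℝ)
    (y : EuclideanSpace ℝ (Fin n)) (β : Fin p → ℝ) : ℝ :=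
  1 / (2 * (n : ℝ)) * ‖y - WithLp.toLp 2 (X *ᵥ β)‖ ^ 2 + lam * ∑ i, w i * |β i|

/-- `βhat` is the lasso estimator, `βhat y = argmin_β objective`: for every response `y`, the
vector `βhat y` is the one and only minimizer of the lasso criterion. -/
def IsLassoEstimator {n p : ℕ} (X : Matrix (Fin n) (Fin p) ℝ) (w : Fin p → ℝ) (lam : ℝ)
    (βhat : EuclideanSpace ℝ (Fin n) → Fin p → ℝ) : Prop :=
  ∀ y, IsMinOn (objective X w lam y) Set.univ (βhat y) ∧
    ∀ β, IsMinOn (objective X w lam y) Set.univ β → β = βhat y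

/-- The Gram matrix `Ψ = XᵀX / n`. -/
def gram {n p : ℕ} (X : Matrix (Fin n) (Fin p) ℝ) : Matrix (Fin p) (Fin p) ℝ :=
  (1 / (n : ℝ)) • (Xᵀ * X)

/-- `s` is a subgradient of the `ℓ₁` norm at `β`. -/
def IsL1Subgradient {p : ℕ} (β s : Fin p → ℝ) : Prop :=
  ∀ i, (β i ≠ 0 → s i = Real.sign (β i)) ∧ (β i = 0 → s i ∈ Set.Icc (-1 : ℝ) 1)

/-- The vector `S` determined by `β` through the KKT equation
`(1/n) Xᵀy = Ψβ + λ W S`, where `W = diag(w)`. -/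
def kktSubgradient {n p : ℕ} (X : Matrix (Fin n) (Fin p) ℝ) (w : Fin p → ℝ) (lam : ℝ)
    (y : EuclideanSpace ℝ (Fin n)) (β : Fin p → ℝ) : Fin p → ℝ :=
  fun i => ((1 / (n : ℝ)) * (Xᵀ *ᵥ y.ofLp) i - (gram X *ᵥ β) i) / (lam * w i)

/-- The space of pairs `(θ, A)`, `θ = (b_A, s_I)`, `A ⊆ {1, …, p}`, where `I` is the complement
of `A`: a point is `⟨A, b_A, s_I⟩`. -/
abbrev AugSpace (p : ℕ) : Type :=
  Σ A : Finset (Fin p), ({i // i ∈ A} → ℝ) × ({i // i ∉ A} → ℝ)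

/-- The augmented estimator `(β̂_𝒜, S_ℐ, 𝒜)` as a function of the response, where `𝒜 = supp β̂`
and `ℐ` is the complement of `𝒜`. -/
def augmented {n p : ℕ} (X : Matrix (Fin n) (Fin p) ℝ) (w : Fin p → ℝ) (lam : ℝ)
    (βhat : EuclideanSpace ℝ (Fin n) → Fin p → ℝ) (y : EuclideanSpace ℝ (Fin n)) : AugSpace p :=
  ⟨Finset.univ.filter fun i => βhat y i ≠ 0,
    fun i => βhat y i, fun i => kktSubgradient X w lam y (βhat y) i⟩

/-- The vector `b ∈ ℝᵖ` with active part `b_A` and zeros off `A`. -/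
def coefOf {p : ℕ} (x : AugSpace p) : Fin p → ℝ :=
  fun i => if h : i ∈ x.1 then x.2.1 ⟨i, h⟩ else 0

/-- The vector `s ∈ ℝᵖ` with `s_A = sgn(b_A)` and inactive part `s_I`. -/
def subgradOf {p : ℕ} (x : AugSpace p) : Fin p → ℝ :=
  fun i => if h : i ∈ x.1 then Real.sign (x.2.1 ⟨i, h⟩) else x.2.2 ⟨i, h⟩

/-- `H(θ, A; μ₀, λ) = Ψ b + λ W s - (1/n) Xᵀ μ₀`. -/
def H {n p : ℕ} (X : Matrix (Fin n) (Fin p) ℝ) (w : Fin p → ℝ) (lam : ℝ)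
    (μ₀ : EuclideanSpace ℝ (Fin n)) (x : AugSpace p) : Fin p → ℝ :=
  gram X *ᵥ coefOf x + lam • (Matrix.diagonal w *ᵥ subgradOf x)
    - (1 / (n : ℝ)) • (Xᵀ *ᵥ μ₀.ofLp)

/-- `V = [V_R | V_N]` is an orthogonal `p × p` matrix whose first `n` columns `V_R` are
eigenvectors of `Ψ` with positive eigenvalues `Λ₁, …, Λₙ`, and whose last `p - n` columns `V_N`
are a basis of the null space of `X`. (`V.toCols₁ = V_R` and `V.toCols₂ = V_N`.) -/
structure IsSpectralMatrix {n p : ℕ} (X : Matrix (Fin n) (Fin p) ℝ)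
    (V : Matrix (Fin p) (Fin n ⊕ Fin (p - n)) ℝ) (Λ : Fin n → ℝ) : Prop where
  transpose_mul_self : Vᵀ * V = 1
  mul_transpose_self : V * Vᵀ = 1
  eigenvectors : ∀ j, gram X *ᵥ V.toCols₁.col j = Λ j • V.toCols₁.col j
  eigenvalues_pos : ∀ j, 0 < Λ j
  span_null : Submodule.span ℝ (Set.range V.toCols₂.col) = LinearMap.ker X.mulVecLin

/-- The rows of a matrix in a finite set `A` of indices: `Z ↦ Z_{A ·}`. -/
def rowsIn {p : ℕ} {κ : Type*} (A : Finset (Fin p)) (Z : Matrix (Fin p) κ ℝ) :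
    Matrix {i // i ∈ A} κ ℝ :=
  Z.submatrix Subtype.val id

/-- The rows of a matrix outside a finite set `A` of indices: `Z ↦ Z_{I ·}`. -/
def rowsOut {p : ℕ} {κ : Type*} (A : Finset (Fin p)) (Z : Matrix (Fin p) κ ℝ) :
    Matrix {i // i ∉ A} κ ℝ :=
  Z.submatrix Subtype.val id

/-- `W_{AA} = diag(wᵢ)_{i ∈ A}`. -/
def weightsIn {p : ℕ} (A : Finset (Fin p)) (w : Fin p → ℝ) :
    Matrix {i // i ∈ A} {i // i ∈ A} ℝ :=
  Matrix.diagonal fun i => w i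

/-- `W_{II} = diag(wᵢ)_{i ∈ I}`. -/
def weightsOut {p : ℕ} (A : Finset (Fin p)) (w : Fin p → ℝ) :
    Matrix {i // i ∉ A} {i // i ∉ A} ℝ :=
  Matrix.diagonal fun i => w i

/-- The left-hand side of the equality constraint,
`V_{AN}ᵀ W_{AA} σ + V_{IN}ᵀ W_{II} s_I`, for a sign vector `σ ∈ ℝ^A` and `s_I ∈ ℝ^I`. -/
def constraintMap {n p : ℕ} (w : Fin p → ℝ) (V : Matrix (Fin p) (Fin n ⊕ Fin (p - n)) ℝ)
    (A : Finset (Fin p)) (σ : {i // i ∈ A} → ℝ) (sI : {i // i ∉ A} → ℝ) : Fin (p - n) → ℝ :=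
  ((rowsIn A V.toCols₂)ᵀ * weightsIn A w) *ᵥ σ + ((rowsOut A V.toCols₂)ᵀ * weightsOut A w) *ᵥ sI

/-- The feasible region: the `(θ, A) = (b_A, s_I, A)` such that all entries of `b_A` are nonzero,
`V_{AN}ᵀ W_{AA} sgn(b_A) + V_{IN}ᵀ W_{II} s_I = 0`, and `‖s_I‖_∞ ≤ 1`. -/
def feasible {n p : ℕ} (w : Fin p → ℝ) (V : Matrix (Fin p) (Fin n ⊕ Fin (p - n)) ℝ) :
    Set (AugSpace p) :=
  {x | (∀ i, x.2.1 i ≠ 0) ∧ constraintMap w V x.1 (fun i => Real.sign (x.2.1 i)) x.2.2 = 0 ∧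
    ∀ i, |x.2.2 i| ≤ 1}

/-- `B` and `s₀` parametrize the solutions `s_I` of the equality constraint for the active set `A`:
the columns of `B` are a basis of the null space of `V_{IN}ᵀ W_{II}`, and for every sign
vector `σ ∈ {-1, 1}^A` the vector `s₀ σ` is a particular solution, so that the solutions are
`s_I = s₀ σ + B s_F`, with `s_F ∈ ℝ^(n - |A|)`. -/
structure IsParametrization {n p : ℕ} (w : Fin p → ℝ)
    (V : Matrix (Fin p) (Fin n ⊕ Fin (p - n)) ℝ) (A : Finset (Fin p))
    (B : Matrix {i // i ∉ A} (Fin (n - A.card)) ℝ)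
    (s₀ : ({i // i ∈ A} → ℝ) → {i // i ∉ A} → ℝ) : Prop where
  linearIndependent : LinearIndependent ℝ B.col
  span_null : Submodule.span ℝ (Set.range B.col) =
    LinearMap.ker ((rowsOut A V.toCols₂)ᵀ * weightsOut A w).mulVecLin
  particular : ∀ σ : {i // i ∈ A} → ℝ, (∀ i, σ i = 1 ∨ σ i = -1) →
    constraintMap w V A σ (s₀ σ) = 0

/-- The measure `dθ = db_A ds_F` for a fixed active set `A`: the image of Lebesgue measure under
`(b_A, s_F) ↦ (b_A, s_I)`, `s_I = s₀ (sgn b_A) + B s_F`. -/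
def thetaMeasure {n p : ℕ} (A : Finset (Fin p)) (B : Matrix {i // i ∉ A} (Fin (n - A.card)) ℝ)
    (s₀ : ({i // i ∈ A} → ℝ) → {i // i ∉ A} → ℝ) :
    Measure (({i // i ∈ A} → ℝ) × ({i // i ∉ A} → ℝ)) :=
  Measure.map (fun u : ({i // i ∈ A} → ℝ) × (Fin (n - A.card) → ℝ) =>
      (u.1, s₀ (fun i => Real.sign (u.1 i)) + B *ᵥ u.2))
    ((volume : Measure ({i // i ∈ A} → ℝ)).prod (volume : Measure (Fin (n - A.card) → ℝ)))

/-- The reference measure for densities of `(θ, A)`: the measure `dθ` on the sheet of each active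
set `A` with `|A| ≤ n`, restricted to the feasible region. -/
def refMeasure {n p : ℕ} (w : Fin p → ℝ) (V : Matrix (Fin p) (Fin n ⊕ Fin (p - n)) ℝ)
    (B : ∀ A : Finset (Fin p), Matrix {i // i ∉ A} (Fin (n - A.card)) ℝ)
    (s₀ : ∀ A : Finset (Fin p), ({i // i ∈ A} → ℝ) → {i // i ∉ A} → ℝ) :
    Measure (AugSpace p) :=
  (∑ A : Finset (Fin p) with A.card ≤ n,
    Measure.map (Sigma.mk A) (thetaMeasure A (B A) (s₀ A))).restrict (feasible w V)

/-- The density of `N_n(0, (σ²/n) diag(Λ))`, as a product of univariate Gaussian densities. -/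
def fR {n : ℕ} (σ : ℝ) (Λ : Fin n → ℝ) (r : Fin n → ℝ) : ℝ :=
  ∏ j, gaussianPDFReal 0 (σ ^ 2 * Λ j / (n : ℝ)).toNNReal (r j)

/-- `T(A; λ) = [V_Rᵀ Ψ_A | λ V_{IR}ᵀ W_{II} B(I)]`, with `|A| + (n - |A|)` columns. -/
def T {n p : ℕ} (X : Matrix (Fin n) (Fin p) ℝ) (w : Fin p → ℝ) (lam : ℝ)
    (V : Matrix (Fin p) (Fin n ⊕ Fin (p - n)) ℝ) (A : Finset (Fin p))
    (B : Matrix {i // i ∉ A} (Fin (n - A.card)) ℝ) :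
    Matrix (Fin n) ({i // i ∈ A} ⊕ Fin (n - A.card)) ℝ :=
  Matrix.fromCols (V.toCols₁ᵀ * (gram X).submatrix id Subtype.val)
    (lam • ((rowsOut A V.toCols₁)ᵀ * weightsOut A w * B))

/-- The numbering of the columns of `T(A; λ)` from left to right, for `|A| ≤ n`. -/
def columnEquiv {n p : ℕ} (A : Finset (Fin p)) (hA : A.card ≤ n) :
    Fin n ≃ {i // i ∈ A} ⊕ Fin (n - A.card) :=
  ((Equiv.sumCongr (A.orderIsoOfFin rfl).symm.toEquiv (Equiv.refl (Fin (n - A.card)))).trans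
    (finSumFinEquiv.trans (finCongr (Nat.add_sub_of_le hA)))).symm

/-- `det T(A; λ)` (for `|A| ≤ n`; set to `0` when `|A| > n`, where `T` is not square). -/
def detT {n p : ℕ} (X : Matrix (Fin n) (Fin p) ℝ) (w : Fin p → ℝ) (lam : ℝ)
    (V : Matrix (Fin p) (Fin n ⊕ Fin (p - n)) ℝ) (A : Finset (Fin p))
    (B : Matrix {i // i ∉ A} (Fin (n - A.card)) ℝ) : ℝ :=
  if hA : A.card ≤ n then ((T X w lam V A B).submatrix id (columnEquiv A hA)).det else 0

/-- The unnormalized density `f_R(V_Rᵀ H(θ, A; μ₀, λ); σ²) |det T(A; λ)|`. -/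
def density {n p : ℕ} (X : Matrix (Fin n) (Fin p) ℝ) (w : Fin p → ℝ) (lam σ : ℝ)
    (μ₀ : EuclideanSpace ℝ (Fin n)) (V : Matrix (Fin p) (Fin n ⊕ Fin (p - n)) ℝ) (Λ : Fin n → ℝ)
    (B : ∀ A : Finset (Fin p), Matrix {i // i ∉ A} (Fin (n - A.card)) ℝ) (x : AugSpace p) : ℝ :=
  fR σ Λ (V.toCols₁ᵀ *ᵥ H X w lam μ₀ x) * |detT X w lam V x.1 (B x.1)|

/-- The density on the selection event: `density · 1{F(θ, A) ∈ 𝓔}`. -/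
def selectedDensity {n p : ℕ} {γ : Type*} (X : Matrix (Fin n) (Fin p) ℝ) (w : Fin p → ℝ)
    (lam σ : ℝ) (μ₀ : EuclideanSpace ℝ (Fin n)) (V : Matrix (Fin p) (Fin n ⊕ Fin (p - n)) ℝ)
    (Λ : Fin n → ℝ) (B : ∀ A : Finset (Fin p), Matrix {i // i ∉ A} (Fin (n - A.card)) ℝ)
    (F : AugSpace p → γ) (E : Set γ) : AugSpace p → ℝ≥0∞ :=
  (F ⁻¹' E).indicator fun x => ENNReal.ofReal (density X w lam σ μ₀ V Λ B x)

end LassoEA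

end

namespace LassoEA

/-! The KKT conditions characterize lasso solutions, and at a point x of the augmented space the KKT
equation reads H(x) = (1/n) Xᵀ(v - μ₀). Expanding in the orthogonal basis V splits it in two: the
V_N coordinates of the right side vanish, which leaves the equality constraint of feasibility, and
the V_R coordinates say `score x = noise v`. Hence (`augmented_eq_iff`) the estimator at v is the
one feasible x whose score is the noise of v. Since `noise` is onto ℝⁿ, `score` is injective on the
feasible region, and the estimator lies in S exactly when the noise lies in score(S ∩ feasible).

The density therefore comes by change of variables from the noise, which is Gaussian with density
`fR` because V_RᵀΨV_R = diag(Λ). On the sheet of a fixed A, in the coordinates (b_A, s_F), the score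
is affine with matrix T wherever the signs of b_A are constant; this gives the factor |det T|.
Uniqueness of the solution forces |A| ≤ n, so finitely many such sheets cover the feasible region,
and injectivity keeps their images disjoint. Summing over A gives the law
(`map_augmented_multivariateGaussian`); conditioning then restricts it to the event and
renormalizes.

Injectivity also makes the estimator measurable, through Lusin–Souslin, without any continuity of
`βhat`. -/

lemma sum_eq_sum_mem_add_sum_notMem {ι M : Type*} [Fintype ι] [DecidableEq ι] [AddCommMonoid M]
    (A : Finset ι) (f : ι → M) :
    ∑ i, f i = ∑ i : {i // i ∈ A}, f i + ∑ i : {i // i ∉ A}, f i := by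
  rw [← Fintype.sum_subtype_add_sum_subtype (· ∈ A)]
  congr!

/-! ### Optimality conditions and the size of the support -/

section KKT

variable {n p : ℕ} {X : Matrix (Fin n) (Fin p) ℝ} {w : Fin p → ℝ} {lam : ℝ}

lemma gram_mulVec (X : Matrix (Fin n) (Fin p) ℝ) (β : Fin p → ℝ) :
    gram X *ᵥ β = (1 / (n : ℝ)) • (Xᵀ *ᵥ (X *ᵥ β)) := by
  rw [gram, smul_mulVec, mulVec_mulVec]

lemma mul_kktSubgradient (hw : ∀ i, 0 < w i) (hlam : 0 < lam) (v : EuclideanSpace ℝ (Fin n))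
    (β : Fin p → ℝ) (i : Fin p) :
    lam * w i * kktSubgradient X w lam v β i =
      (1 / (n : ℝ)) * (Xᵀ *ᵥ v.ofLp) i - (gram X *ᵥ β) i := by
  have := (hw i).ne'
  have := hlam.ne'
  rw [kktSubgradient]
  field_simp

/-- The exact increment of the lasso criterion in terms of the KKT vector. -/
lemma objective_add (hn : 0 < n) (hw : ∀ i, 0 < w i) (hlam : 0 < lam)
    (v : EuclideanSpace ℝ (Fin n)) (β h : Fin p → ℝ) :
    objective X w lam v (β + h) = objective X w lam v β
      + 1 / (2 * (n : ℝ)) * ‖WithLp.toLp 2 (X *ᵥ h)‖ ^ 2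
      + lam * ∑ i, w i * (|β i + h i| - |β i| - kktSubgradient X w lam v β i * h i) := by
  have hn' : (n : ℝ) ≠ 0 := by positivity
  have hinner : ∑ i, lam * w i * kktSubgradient X w lam v β i * h i =
      (1 / (n : ℝ)) * ((v.ofLp - X *ᵥ β) ⬝ᵥ (X *ᵥ h)) := by
    have : ∀ i, lam * w i * kktSubgradient X w lam v β i * h i =
        (1 / (n : ℝ)) * ((Xᵀ *ᵥ (v.ofLp - X *ᵥ β)) i * h i) := by
      intro i
      rw [mul_kktSubgradient hw hlam, gram_mulVec, mulVec_sub]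
      simp only [Pi.smul_apply, Pi.sub_apply, smul_eq_mul]
      ring
    simp_rw [this]
    rw [← Finset.mul_sum, dotProduct_mulVec, ← mulVec_transpose]
    rfl
  have hsq : ‖v - WithLp.toLp 2 (X *ᵥ (β + h))‖ ^ 2 = ‖v - WithLp.toLp 2 (X *ᵥ β)‖ ^ 2
      - 2 * ((v.ofLp - X *ᵥ β) ⬝ᵥ (X *ᵥ h)) + ‖WithLp.toLp 2 (X *ᵥ h)‖ ^ 2 := by
    simp only [EuclideanSpace.real_norm_sq_eq, dotProduct, mulVec_add, Finset.mul_sum,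
      ← Finset.sum_add_distrib, ← Finset.sum_sub_distrib]
    refine Finset.sum_congr rfl fun i _ => ?_
    simp only [PiLp.sub_apply, Pi.add_apply, Pi.sub_apply]
    ring
  have hsum : lam * ∑ i, w i * (|β i + h i| - |β i| - kktSubgradient X w lam v β i * h i) =
      lam * ∑ i, w i * |β i + h i| - lam * ∑ i, w i * |β i|
        - ∑ i, lam * w i * kktSubgradient X w lam v β i * h i := by
    simp only [Finset.mul_sum, ← Finset.sum_sub_distrib]
    refine Finset.sum_congr rfl fun i _ => ?_
    ring
  rw [hsum, hinner, objective, objective, hsq]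
  simp only [Pi.add_apply]
  field_simp
  ring

lemma abs_add_sub_nonneg_of_subgradient {b s : ℝ} (h₁ : b ≠ 0 → s = Real.sign b)
    (h₂ : b = 0 → s ∈ Set.Icc (-1 : ℝ) 1) (t : ℝ) : 0 ≤ |b + t| - |b| - s * t := by
  rcases lt_trichotomy b 0 with hb | hb | hb
  · rw [h₁ hb.ne, Real.sign_of_neg hb, abs_of_neg hb]
    linarith [neg_abs_le (b + t)]
  · obtain ⟨h3, h4⟩ := h₂ hb
    subst hb
    have : s * t ≤ |s * t| := le_abs_self _
    rw [abs_mul] at this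
    have : |s| * |t| ≤ 1 * |t| := by gcongr; exact abs_le.2 ⟨h3, h4⟩
    simp only [zero_add, abs_zero]
    linarith
  · rw [h₁ hb.ne', Real.sign_of_pos hb, abs_of_pos hb]
    linarith [le_abs_self (b + t)]

/-- Both correction terms in `objective_add` are nonnegative: the square, and the penalty term by
the subgradient inequality in each coordinate. -/
lemma isMinOn_of_isL1Subgradient (hn : 0 < n) (hw : ∀ i, 0 < w i) (hlam : 0 < lam)
    {v : EuclideanSpace ℝ (Fin n)} {β : Fin p → ℝ}
    (h : IsL1Subgradient β (kktSubgradient X w lam v β)) :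
    IsMinOn (objective X w lam v) Set.univ β := by
  intro β' _
  have := objective_add (X := X) hn hw hlam v β (β' - β)
  rw [add_sub_cancel] at this
  simp only [Set.mem_ofPred_eq]
  rw [this, add_assoc]
  refine le_add_of_nonneg_right (add_nonneg (by positivity) (mul_nonneg hlam.le ?_))
  exact Finset.sum_nonneg fun i _ => mul_nonneg (hw i).le
    (abs_add_sub_nonneg_of_subgradient (h i).1 (h i).2 _)

/-- Divide by t and let t → 0⁺. This extracts the one-sided first-order condition from the exact
increment of the criterion. -/
lemma nonneg_of_forall_small_quadratic {a c δ : ℝ} (hδ : 0 < δ)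
    (h : ∀ t, 0 < t → t < δ → 0 ≤ c * t ^ 2 + a * t) : 0 ≤ a := by
  have hlim : Filter.Tendsto (fun t : ℝ => c * t + a) (nhdsWithin 0 (Set.Ioi 0)) (nhds a) := by
    have : Continuous fun t : ℝ => c * t + a := by fun_prop
    have := (this.tendsto 0).mono_left (nhdsWithin_le_nhds (s := Set.Ioi 0))
    simpa using this
  refine ge_of_tendsto hlim ?_
  filter_upwards [Ioo_mem_nhdsGT hδ] with t ht
  have := h t ht.1 ht.2
  have h2 : 0 ≤ t * (c * t + a) := by nlinarith
  exact nonneg_of_mul_nonneg_right h2 ht.1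

lemma isL1Subgradient_of_isMinOn (hn : 0 < n) (hw : ∀ i, 0 < w i) (hlam : 0 < lam)
    {v : EuclideanSpace ℝ (Fin n)} {β : Fin p → ℝ}
    (h : IsMinOn (objective X w lam v) Set.univ β) :
    IsL1Subgradient β (kktSubgradient X w lam v β) := by
  intro i
  set s := kktSubgradient X w lam v β i with hs
  -- Moving only coordinate i, by t * d, isolates the i-th penalty term; c is the coefficient of the
  -- quadratic fit term.
  have key : ∀ d : ℝ, ∃ c, ∀ t,
      0 ≤ c * t ^ 2 + lam * w i * (|β i + t * d| - |β i| - s * (t * d)) := by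
    intro d
    refine ⟨1 / (2 * (n : ℝ)) * ‖WithLp.toLp 2 (X *ᵥ Pi.single i d)‖ ^ 2, fun t => ?_⟩
    have h1 := h (Set.mem_univ (β + t • Pi.single i d))
    simp only [Set.mem_ofPred_eq] at h1
    rw [objective_add hn hw hlam, mulVec_smul, WithLp.toLp_smul, norm_smul,
      Finset.sum_eq_single i] at h1
    · simp only [Pi.smul_apply, Pi.single_eq_same, smul_eq_mul, mul_pow, Real.norm_eq_abs,
        sq_abs] at h1
      rw [← hs] at h1
      linarith
    · intro j _ hj
      simp [hj]
    · simp
  have hpos := mul_pos hlam (hw i)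
  have up : (0 ≤ β i → s ≤ 1) ∧ (β i ≤ 0 → -1 ≤ s) := by
    constructor
    · intro hb
      obtain ⟨c, hc⟩ := key 1
      have := nonneg_of_forall_small_quadratic (a := lam * w i * (1 - s)) (c := c) one_pos
        fun t ht _ => by
          have := hc t
          rw [abs_of_nonneg (by linarith), abs_of_nonneg hb] at this
          linarith
      have := nonneg_of_mul_nonneg_right this hpos
      linarith
    · intro hb
      obtain ⟨c, hc⟩ := key (-1)
      have := nonneg_of_forall_small_quadratic (a := lam * w i * (1 + s)) (c := c) one_pos
        fun t ht _ => by
          have := hc t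
          rw [abs_of_nonpos (by linarith), abs_of_nonpos hb] at this
          linarith
      have := nonneg_of_mul_nonneg_right this hpos
      linarith
  refine ⟨fun hb => ?_, fun hb => ⟨up.2 hb.le, up.1 hb.ge⟩⟩
  rcases hb.lt_or_gt with hb | hb
  · rw [Real.sign_of_neg hb]
    refine le_antisymm ?_ (up.2 hb.le)
    obtain ⟨c, hc⟩ := key 1
    -- The bound t < -βᵢ keeps βᵢ + t negative, so the absolute value is linear over the range used.
    have := nonneg_of_forall_small_quadratic (a := lam * w i * (-1 - s)) (c := c) (neg_pos.2 hb)
      fun t ht ht' => by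
        have := hc t
        rw [abs_of_neg (by linarith), abs_of_neg hb] at this
        linarith
    have := nonneg_of_mul_nonneg_right this hpos
    linarith
  · rw [Real.sign_of_pos hb]
    refine le_antisymm (up.1 hb.le) ?_
    obtain ⟨c, hc⟩ := key (-1)
    have := nonneg_of_forall_small_quadratic (a := lam * w i * (s - 1)) (c := c) hb
      fun t ht ht' => by
        have := hc t
        rw [abs_of_pos (by linarith), abs_of_pos hb] at this
        linarith
    have := nonneg_of_mul_nonneg_right this hpos
    linarith

lemma abs_add_eq_of_abs_lt {b t : ℝ} (h : |t| < |b|) : |b + t| = |b| + Real.sign b * t := by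
  rcases lt_trichotomy b 0 with hb | rfl | hb
  · rw [abs_of_neg hb] at h ⊢
    have := (abs_lt.1 h).2
    rw [Real.sign_of_neg hb, abs_of_neg (by linarith)]
    ring
  · simp only [abs_zero] at h
    exact absurd h (abs_nonneg t).not_gt
  · rw [abs_of_pos hb] at h ⊢
    have := (abs_lt.1 h).1
    rw [Real.sign_of_pos hb, abs_of_pos (by linarith)]
    ring

/-- Uniqueness of the lasso solution forces its support to have at most `n` elements. -/
lemma card_support_le {βhat : EuclideanSpace ℝ (Fin n) → Fin p → ℝ}
    (hn : 0 < n) (hw : ∀ i, 0 < w i) (hlam : 0 < lam)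
    (hβ : IsLassoEstimator X w lam βhat) (v : EuclideanSpace ℝ (Fin n)) :
    (Finset.univ.filter fun i => βhat v i ≠ 0).card ≤ n := by
  by_contra! hcard
  set A := Finset.univ.filter fun i => βhat v i ≠ 0 with hA
  obtain ⟨hmin, huniq⟩ := hβ v
  have hsub := isL1Subgradient_of_isMinOn hn hw hlam hmin
  -- More than n active columns in ℝⁿ satisfy a linear relation u. Moving along it leaves the fit
  -- unchanged.
  have hker := LinearMap.ker_ne_bot_of_finrank_lt
    (f := (X.submatrix id (Subtype.val : {i // i ∈ A} → Fin p)).mulVecLin) (by simpa using hcard)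
  obtain ⟨u, hu, hu0⟩ := (Submodule.ne_bot_iff _).1 hker
  let h : Fin p → ℝ := fun i => if hi : i ∈ A then u ⟨i, hi⟩ else 0
  have hXh : X *ᵥ h = 0 := by
    rw [LinearMap.mem_ker, mulVecLin_apply] at hu
    rw [← hu]
    ext k
    simp only [mulVec, dotProduct, submatrix_apply, id]
    rw [sum_eq_sum_mem_add_sum_notMem A, Fintype.sum_eq_zero (fun i : {i // i ∉ A} => X k i * h i)
      fun i => by simp [h, i.2], add_zero]
    exact Fintype.sum_congr _ _ fun i => by simp [h, i.2]
  have hev : ∀ᶠ t : ℝ in nhdsWithin 0 (Set.Ioi 0), ∀ i : {i // i ∈ A}, |t * h i| < |βhat v i| := by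
    refine Filter.eventually_all.2 fun i => ?_
    have hc : Continuous fun t : ℝ => |t * h i| := by fun_prop
    have := hc.tendsto 0
    simp only [zero_mul, abs_zero] at this
    exact nhdsWithin_le_nhds (this.eventually
      (gt_mem_nhds (abs_pos.2 (Finset.mem_filter.1 i.2).2)))
  obtain ⟨t, ht, ht0⟩ := (hev.and self_mem_nhdsWithin).exists
  -- For this small t no active sign changes, so the penalty is linear along the move and its change
  -- cancels the subgradient term: a second minimizer.
  have hobj : objective X w lam v (βhat v + t • h) = objective X w lam v (βhat v) := by
    rw [objective_add hn hw hlam, mulVec_smul, hXh, Finset.sum_eq_zero]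
    · simp
    · intro i _
      by_cases hi : i ∈ A
      · have h1 := ht ⟨i, hi⟩
        simp only at h1
        simp only [Pi.smul_apply, smul_eq_mul]
        rw [abs_add_eq_of_abs_lt h1, (hsub i).1 (Finset.mem_filter.1 hi).2]
        ring
      · simp [h, hi]
  have heq := huniq (βhat v + t • h) fun β' hβ' => by
    simp only [Set.mem_ofPred_eq]
    rw [hobj]
    exact hmin hβ'
  have hh : t • h = 0 := by simpa using heq
  have hh0 : h = 0 := (smul_eq_zero.1 hh).resolve_left (ne_of_gt ht0)
  refine hu0 (funext fun i => ?_)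
  have := congrFun hh0 i
  simpa [h, i.2] using this

end KKT

/-! ### The KKT equation in the coordinates of V -/

section Score

variable {n p : ℕ} {X : Matrix (Fin n) (Fin p) ℝ} {w : Fin p → ℝ} {lam : ℝ}
  {βhat : EuclideanSpace ℝ (Fin n) → Fin p → ℝ} {μ₀ : EuclideanSpace ℝ (Fin n)}
  {V : Matrix (Fin p) (Fin n ⊕ Fin (p - n)) ℝ} {Λ : Fin n → ℝ}

/-- The coordinates `V_Rᵀ H(θ, A; μ₀, λ)` of `H` in the row space of `X`. -/
noncomputable def score (X : Matrix (Fin n) (Fin p) ℝ) (w : Fin p → ℝ) (lam : ℝ)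
    (μ₀ : EuclideanSpace ℝ (Fin n)) (V : Matrix (Fin p) (Fin n ⊕ Fin (p - n)) ℝ)
    (x : AugSpace p) : Fin n → ℝ :=
  V.toCols₁ᵀ *ᵥ H X w lam μ₀ x

/-- The matrix `V_Rᵀ Xᵀ / n`. -/
noncomputable def noiseMatrix (X : Matrix (Fin n) (Fin p) ℝ)
    (V : Matrix (Fin p) (Fin n ⊕ Fin (p - n)) ℝ) :
    Matrix (Fin n) (Fin n) ℝ :=
  (1 / (n : ℝ)) • (V.toCols₁ᵀ * Xᵀ)

/-- The coordinates `V_Rᵀ Xᵀ (v - μ₀) / n` of the noise. -/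
noncomputable def noise (X : Matrix (Fin n) (Fin p) ℝ) (μ₀ : EuclideanSpace ℝ (Fin n))
    (V : Matrix (Fin p) (Fin n ⊕ Fin (p - n)) ℝ) (v : EuclideanSpace ℝ (Fin n)) : Fin n → ℝ :=
  noiseMatrix X V *ᵥ (v.ofLp - μ₀.ofLp)

lemma IsSpectralMatrix.toCols₁_transpose_mul_self (hV : IsSpectralMatrix X V Λ) :
    V.toCols₁ᵀ * V.toCols₁ = 1 := by
  ext i j
  have := congrFun (congrFun hV.transpose_mul_self (Sum.inl i)) (Sum.inl j)
  simpa [mul_apply, one_apply] using this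

lemma IsSpectralMatrix.mul_toCols₂ (hV : IsSpectralMatrix X V Λ) : X * V.toCols₂ = 0 := by
  ext i j
  have h : V.toCols₂.col j ∈ LinearMap.ker X.mulVecLin :=
    hV.span_null ▸ Submodule.subset_span ⟨j, rfl⟩
  exact congrFun (LinearMap.mem_ker.1 h) i

lemma IsSpectralMatrix.toCols₂_transpose_mul (hV : IsSpectralMatrix X V Λ) :
    V.toCols₂ᵀ * Xᵀ = 0 := by
  rw [← transpose_mul, hV.mul_toCols₂, transpose_zero]

/-- A vector is determined by its coordinates in `V_R` and `V_N`. -/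
lemma IsSpectralMatrix.ext (hV : IsSpectralMatrix X V Λ) {a b : Fin p → ℝ}
    (h₁ : V.toCols₁ᵀ *ᵥ a = V.toCols₁ᵀ *ᵥ b) (h₂ : V.toCols₂ᵀ *ᵥ a = V.toCols₂ᵀ *ᵥ b) :
    a = b := by
  have h : Vᵀ *ᵥ a = Vᵀ *ᵥ b := by
    ext (j | j)
    · exact congrFun h₁ j
    · exact congrFun h₂ j
  rw [← one_mulVec a, ← one_mulVec b, ← hV.mul_transpose_self, ← mulVec_mulVec, h, mulVec_mulVec]

/-- The product is (1/n) V_Rᵀ Ψ V_R, and ΨV_R = V_R diag(Λ). Up to the factor σ² this is the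
covariance of the noise. -/
lemma IsSpectralMatrix.noiseMatrix_mul_transpose (hV : IsSpectralMatrix X V Λ) :
    noiseMatrix X V * (noiseMatrix X V)ᵀ = (1 / (n : ℝ)) • diagonal Λ := by
  have hg : gram X * V.toCols₁ = V.toCols₁ * diagonal Λ := by
    ext i j
    have := congrFun (hV.eigenvectors j) i
    rw [mul_diagonal]
    simpa [mul_comm, mulVec, dotProduct, mul_apply] using this
  have : noiseMatrix X V * (noiseMatrix X V)ᵀ =
      (1 / (n : ℝ)) • (V.toCols₁ᵀ * (gram X * V.toCols₁)) := by
    simp only [noiseMatrix, gram, transpose_smul, transpose_mul, transpose_transpose,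
      Matrix.mul_assoc, smul_mul,
      Matrix.mul_smul]
  rw [this, hg, ← Matrix.mul_assoc, hV.toCols₁_transpose_mul_self, Matrix.one_mul]

lemma IsSpectralMatrix.noise_surjective (hn : 0 < n) (hV : IsSpectralMatrix X V Λ) :
    Function.Surjective (noise X μ₀ V) := by
  intro r
  have hn' : (n : ℝ) ≠ 0 := by positivity
  -- With M the noise matrix, M Mᵀ = diag(Λ)/n, so Mᵀ n diag(Λ)⁻¹ is a right inverse of M.
  refine ⟨WithLp.toLp 2 (μ₀.ofLp +
    (noiseMatrix X V)ᵀ *ᵥ ((n : ℝ) • (diagonal (fun j => (Λ j)⁻¹) *ᵥ r))), ?_⟩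
  simp only [noise, add_sub_cancel_left, mulVec_mulVec, hV.noiseMatrix_mul_transpose]
  ext j
  have := (hV.eigenvalues_pos j).ne'
  simp only [smul_mulVec, mulVec_smul, mulVec_diagonal, Pi.smul_apply, smul_eq_mul]
  field_simp

/-- The linear constraint says that the subgradient part of `H` is orthogonal to `V_N`. -/
lemma constraintMap_eq (x : AugSpace p) :
    constraintMap w V x.1 (fun i => Real.sign (x.2.1 i)) x.2.2 =
      V.toCols₂ᵀ *ᵥ (diagonal w *ᵥ subgradOf x) := by
  ext j
  simp only [constraintMap, weightsIn, weightsOut, ← mulVec_mulVec]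
  change ∑ i : {i // i ∈ x.1}, V.toCols₂ i.1 j * _ + ∑ i : {i // i ∉ x.1}, V.toCols₂ i.1 j * _ =
    ∑ i, V.toCols₂ i j * _
  rw [sum_eq_sum_mem_add_sum_notMem x.1]
  congr 1
  · refine Finset.sum_congr rfl fun i _ => ?_
    simp only [mulVec_diagonal]
    simp [subgradOf]
  · refine Finset.sum_congr rfl fun i _ => ?_
    simp only [mulVec_diagonal]
    simp [subgradOf, i.2]

/-- V_Nᵀ annihilates Xᵀ, hence the Gram term and the μ₀ term; only the subgradient part survives. -/
lemma toCols₂_mulVec_H (hV : IsSpectralMatrix X V Λ) (x : AugSpace p) :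
    V.toCols₂ᵀ *ᵥ H X w lam μ₀ x =
      lam • constraintMap w V x.1 (fun i => Real.sign (x.2.1 i)) x.2.2 := by
  rw [constraintMap_eq, H, gram_mulVec, mulVec_sub, mulVec_add]
  simp only [mulVec_smul]
  simp only [hV.toCols₂_transpose_mul, mulVec_mulVec _ V.toCols₂ᵀ]
  simp

/-- The KKT equation for a point of the augmented space, in terms of `H`. -/
lemma kktSubgradient_coefOf_eq_iff (hw : ∀ i, 0 < w i) (hlam : 0 < lam)
    (v : EuclideanSpace ℝ (Fin n)) (x : AugSpace p) :
    kktSubgradient X w lam v (coefOf x) = subgradOf x ↔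
      H X w lam μ₀ x = (1 / (n : ℝ)) • (Xᵀ *ᵥ (v.ofLp - μ₀.ofLp)) := by
  simp only [funext_iff]
  refine forall_congr' fun i => ?_
  have := mul_kktSubgradient (X := X) hw hlam v (coefOf x) i
  have hpos := mul_pos hlam (hw i)
  rw [← mul_right_inj' hpos.ne', this, mulVec_sub]
  simp only [H, Pi.sub_apply, Pi.add_apply, Pi.smul_apply, mulVec_diagonal, smul_eq_mul]
  constructor <;> intro h <;> linarith

lemma coefOf_augmented (v : EuclideanSpace ℝ (Fin n)) :
    coefOf (augmented X w lam βhat v) = βhat v := by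
  ext i
  by_cases hi : βhat v i = 0 <;> simp [coefOf, augmented, hi]

lemma augSpace_ext {x x' : AugSpace p} (hA : x.1 = x'.1) (hb : coefOf x = coefOf x')
    (hs : subgradOf x = subgradOf x') : x = x' := by
  obtain ⟨A, b, s⟩ := x
  obtain ⟨A', b', s'⟩ := x'
  obtain rfl : A = A' := hA
  have h1 : b = b' := by
    ext i
    simpa [coefOf] using congrFun hb i
  have h2 : s = s' := by
    ext i
    simpa [subgradOf, i.2] using congrFun hs i
  rw [h1, h2]

lemma subgradOf_augmented (hn : 0 < n) (hw : ∀ i, 0 < w i) (hlam : 0 < lam)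
    (hβ : IsLassoEstimator X w lam βhat) (v : EuclideanSpace ℝ (Fin n)) :
    subgradOf (augmented X w lam βhat v) = kktSubgradient X w lam v (βhat v) := by
  have hsub := isL1Subgradient_of_isMinOn hn hw hlam (hβ v).1
  ext i
  by_cases hi : βhat v i = 0
  · simp [subgradOf, augmented, hi]
  · simp [subgradOf, augmented, hi, (hsub i).1 hi]

/-- A point of the augmented space is the augmented estimator at `v` exactly when it is feasible
and its score is the noise at `v`. -/
lemma augmented_eq_iff (hn : 0 < n) (hw : ∀ i, 0 < w i) (hlam : 0 < lam)
    (hβ : IsLassoEstimator X w lam βhat) (hV : IsSpectralMatrix X V Λ)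
    (v : EuclideanSpace ℝ (Fin n)) (x : AugSpace p) :
    augmented X w lam βhat v = x ↔
      x ∈ feasible w V ∧ score X w lam μ₀ V x = noise X μ₀ V v := by
  have hnoise : noise X μ₀ V v =
      V.toCols₁ᵀ *ᵥ ((1 / (n : ℝ)) • (Xᵀ *ᵥ (v.ofLp - μ₀.ofLp))) := by
    rw [noise, noiseMatrix, smul_mulVec, mulVec_smul, mulVec_mulVec]
  have hzero : V.toCols₂ᵀ *ᵥ ((1 / (n : ℝ)) • (Xᵀ *ᵥ (v.ofLp - μ₀.ofLp))) = 0 := by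
    rw [mulVec_smul, mulVec_mulVec, hV.toCols₂_transpose_mul, zero_mulVec, smul_zero]
  constructor
  · rintro rfl
    have hsub := isL1Subgradient_of_isMinOn hn hw hlam (hβ v).1
    have hH := (kktSubgradient_coefOf_eq_iff (X := X) (μ₀ := μ₀) hw hlam v
      (augmented X w lam βhat v)).1 (by rw [coefOf_augmented, subgradOf_augmented hn hw hlam hβ])
    refine ⟨⟨fun i => (Finset.mem_filter.1 i.2).2, ?_, fun i => ?_⟩, ?_⟩
    · have := toCols₂_mulVec_H (w := w) (lam := lam) (μ₀ := μ₀) hV (augmented X w lam βhat v)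
      rw [hH, hzero] at this
      exact (smul_eq_zero.1 this.symm).resolve_left hlam.ne'
    · have : βhat v i = 0 := by
        by_contra h
        exact i.2 (Finset.mem_filter.2 ⟨Finset.mem_univ _, h⟩)
      exact abs_le.2 ((hsub i).2 this)
    · rw [score, hH, hnoise]
  · rintro ⟨⟨hb, hc, hs⟩, hscore⟩
    have hH : H X w lam μ₀ x = (1 / (n : ℝ)) • (Xᵀ *ᵥ (v.ofLp - μ₀.ofLp)) := by
      refine hV.ext (by rw [← hnoise, ← hscore, score]) ?_
      rw [toCols₂_mulVec_H hV, hc, hzero, smul_zero]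
    have hk := (kktSubgradient_coefOf_eq_iff hw hlam v x).2 hH
    have hmem : ∀ i, coefOf x i ≠ 0 ↔ i ∈ x.1 := by
      intro i
      by_cases hi : i ∈ x.1
      · simp [coefOf, hi, hb ⟨i, hi⟩]
      · simp [coefOf, hi]
    -- Feasibility makes the KKT vector of `coefOf x` a subgradient, so `coefOf x` is optimal, and
    -- uniqueness identifies it with `βhat v`.
    have hmin : IsMinOn (objective X w lam v) Set.univ (coefOf x) := by
      refine isMinOn_of_isL1Subgradient hn hw hlam fun i => ?_
      rw [hk]
      constructor
      · intro h
        have hi := (hmem i).1 h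
        simp [subgradOf, coefOf, hi]
      · intro h
        have hi : i ∉ x.1 := fun hi => (hmem i).2 hi h
        simp only [subgradOf, hi, dite_false]
        exact abs_le.1 (hs ⟨i, hi⟩)
    have hβx := (hβ v).2 _ hmin
    refine augSpace_ext ?_ ?_ ?_
    · ext i
      simp [augmented, ← hβx, ← hmem]
    · rw [coefOf_augmented, hβx]
    · rw [subgradOf_augmented hn hw hlam hβ, ← hβx, hk]

/-- Some v has the common score as its noise, and both points then equal the estimator at v. -/
lemma injOn_score (hn : 0 < n) (hw : ∀ i, 0 < w i) (hlam : 0 < lam)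
    (hβ : IsLassoEstimator X w lam βhat) (hV : IsSpectralMatrix X V Λ) :
    Set.InjOn (score X w lam μ₀ V) (feasible w V) := by
  intro x hx x' hx' h
  obtain ⟨v, hv⟩ := hV.noise_surjective (μ₀ := μ₀) hn (score X w lam μ₀ V x)
  rw [← (augmented_eq_iff hn hw hlam hβ hV v x).2 ⟨hx, hv.symm⟩,
    (augmented_eq_iff hn hw hlam hβ hV v x').2 ⟨hx', h ▸ hv.symm⟩]

/-- Every feasible point is a value of the estimator, so the bound on lasso supports applies.
Feasibility does not involve μ₀, so the centre 0 serves. -/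
lemma card_le_of_mem_feasible (hn : 0 < n) (hw : ∀ i, 0 < w i) (hlam : 0 < lam)
    (hβ : IsLassoEstimator X w lam βhat) (hV : IsSpectralMatrix X V Λ) {x : AugSpace p}
    (hx : x ∈ feasible w V) : x.1.card ≤ n := by
  obtain ⟨v, hv⟩ := hV.noise_surjective (μ₀ := 0) hn (score X w lam 0 V x)
  rw [← (augmented_eq_iff hn hw hlam hβ hV v x).2 ⟨hx, hv.symm⟩]
  exact card_support_le hn hw hlam hβ v

lemma preimage_augmented (hn : 0 < n) (hw : ∀ i, 0 < w i) (hlam : 0 < lam)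
    (hβ : IsLassoEstimator X w lam βhat) (hV : IsSpectralMatrix X V Λ) (S : Set (AugSpace p)) :
    augmented X w lam βhat ⁻¹' S =
      noise X μ₀ V ⁻¹' (score X w lam μ₀ V '' (S ∩ feasible w V)) := by
  ext v
  constructor
  · intro hv
    obtain ⟨h1, h2⟩ := (augmented_eq_iff (μ₀ := μ₀) hn hw hlam hβ hV v _).1 rfl
    exact ⟨_, ⟨hv, h1⟩, h2⟩
  · rintro ⟨x, ⟨hxS, hxf⟩, hx⟩
    have := (augmented_eq_iff hn hw hlam hβ hV v x).2 ⟨hxf, hx⟩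
    simpa [this] using hxS

end Score

/-! ### Measurability of the estimator -/

section Measurability

variable {n p : ℕ} {X : Matrix (Fin n) (Fin p) ℝ} {w : Fin p → ℝ} {lam : ℝ}
  {βhat : EuclideanSpace ℝ (Fin n) → Fin p → ℝ} {μ₀ : EuclideanSpace ℝ (Fin n)}
  {V : Matrix (Fin p) (Fin n ⊕ Fin (p - n)) ℝ} {Λ : Fin n → ℝ}

lemma measurableSet_sigma_iff {ι : Type*} {α : ι → Type*} [∀ i, MeasurableSpace (α i)]
    {S : Set (Sigma α)} : MeasurableSet S ↔ ∀ i, MeasurableSet (Sigma.mk i ⁻¹' S) := by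
  simp only [MeasurableSpace.measurableSet_iInf,
    MeasurableSpace.map_def]

lemma measurable_sigma_mk {ι : Type*} {α : ι → Type*} [∀ i, MeasurableSpace (α i)] (i : ι) :
    Measurable (Sigma.mk i : α i → Sigma α) :=
  fun _ hS => measurableSet_sigma_iff.1 hS i

lemma measurable_sigma_iff {ι β : Type*} {α : ι → Type*} [∀ i, MeasurableSpace (α i)]
    [MeasurableSpace β] {f : Sigma α → β} : Measurable f ↔ ∀ i, Measurable (f ∘ Sigma.mk i) :=
  ⟨fun h i => h.comp (measurable_sigma_mk i),
    fun h _ hS => measurableSet_sigma_iff.2 fun i => h i hS⟩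

lemma measurable_real_sign : Measurable Real.sign :=
  Measurable.ite measurableSet_Iio measurable_const
    (Measurable.ite measurableSet_Ioi measurable_const measurable_const)

lemma measurable_mulVec {k m : Type*} [Fintype m] (M : Matrix k m ℝ) :
    Measurable fun x : m → ℝ => M *ᵥ x := by
  refine measurable_pi_lambda _ fun i => ?_
  simp only [mulVec, dotProduct]
  fun_prop

lemma measurable_fst_apply {ι κ : Type*} (i : ι) :
    Measurable fun u : (ι → ℝ) × (κ → ℝ) => u.1 i := by
  fun_prop

lemma measurable_snd_apply {ι κ : Type*} (i : κ) :
    Measurable fun u : (ι → ℝ) × (κ → ℝ) => u.2 i := by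
  fun_prop

lemma measurable_coefOf : Measurable (coefOf : AugSpace p → Fin p → ℝ) := by
  refine measurable_sigma_iff.2 fun A => measurable_pi_lambda _ fun i => ?_
  by_cases hi : i ∈ A
  · simp only [Function.comp_apply, coefOf, hi, dite_true]
    exact measurable_fst_apply (⟨i, hi⟩ : {i // i ∈ A})
  · simp [coefOf, hi]

lemma measurable_subgradOf : Measurable (subgradOf : AugSpace p → Fin p → ℝ) := by
  refine measurable_sigma_iff.2 fun A => measurable_pi_lambda _ fun i => ?_
  by_cases hi : i ∈ A
  · simp only [Function.comp_apply, subgradOf, hi, dite_true]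
    exact measurable_real_sign.comp (measurable_fst_apply (⟨i, hi⟩ : {i // i ∈ A}))
  · simp only [Function.comp_apply, subgradOf, hi, dite_false]
    exact measurable_snd_apply (⟨i, hi⟩ : {i // i ∉ A})

lemma measurable_score : Measurable (score X w lam μ₀ V) := by
  refine (measurable_mulVec _).comp ?_
  unfold H
  exact ((measurable_mulVec _).comp measurable_coefOf).add
    (((measurable_mulVec _).comp measurable_subgradOf).const_smul lam) |>.sub_const _

lemma measurable_noise : Measurable (noise X μ₀ V) := by
  refine (measurable_mulVec _).comp ?_
  fun_prop

lemma measurableSet_feasible : MeasurableSet (feasible w V) := by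
  refine measurableSet_sigma_iff.2 fun A => ?_
  have h1 : MeasurableSet {u : ({i // i ∈ A} → ℝ) × ({i // i ∉ A} → ℝ) | ∀ i, u.1 i ≠ 0} := by
    rw [Set.ofPred_forall]
    exact MeasurableSet.iInter fun i =>
      (measurableSet_singleton (0 : ℝ)).compl.preimage (by fun_prop : Measurable
        fun u : ({i // i ∈ A} → ℝ) × ({i // i ∉ A} → ℝ) => u.1 i)
  have h2 : MeasurableSet {u : ({i // i ∈ A} → ℝ) × ({i // i ∉ A} → ℝ) |
      constraintMap w V A (fun i => Real.sign (u.1 i)) u.2 = 0} := by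
    refine measurableSet_eq_fun ?_ measurable_const
    refine Measurable.add ((measurable_mulVec _).comp ?_) ((measurable_mulVec _).comp ?_)
    · exact measurable_pi_lambda _ fun i => measurable_real_sign.comp (by fun_prop)
    · fun_prop
  have h3 : MeasurableSet {u : ({i // i ∈ A} → ℝ) × ({i // i ∉ A} → ℝ) | ∀ i, |u.2 i| ≤ 1} := by
    rw [Set.ofPred_forall]
    exact MeasurableSet.iInter fun i => measurableSet_le (by fun_prop) measurable_const
  exact h1.inter (h2.inter h3)

lemma image_eq_iUnion_sigma {ι β : Type*} {α : ι → Type*} (f : Sigma α → β) (S : Set (Sigma α)) :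
    f '' S = ⋃ i, (f ∘ Sigma.mk i) '' (Sigma.mk i ⁻¹' S) := by
  ext b
  simp only [Set.mem_image, Set.mem_iUnion, Set.mem_preimage, Function.comp_apply, Sigma.exists]

/-- The point `(θ, A)` of the augmented space. -/
abbrev onSheet (A : Finset (Fin p)) (u : ({i // i ∈ A} → ℝ) × ({i // i ∉ A} → ℝ)) : AugSpace p :=
  ⟨A, u⟩

lemma onSheet_injective (A : Finset (Fin p)) : Function.Injective (onSheet A) :=
  fun _ _ h => eq_of_heq (Sigma.mk.inj h).2

/-- The score maps measurable sets of feasible points to measurable sets (Lusin–Souslin). -/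
lemma measurableSet_image_score (hn : 0 < n) (hw : ∀ i, 0 < w i) (hlam : 0 < lam)
    (hβ : IsLassoEstimator X w lam βhat) (hV : IsSpectralMatrix X V Λ)
    {S : Set (AugSpace p)} (hS : MeasurableSet S) (A : Finset (Fin p)) :
    MeasurableSet ((fun u => score X w lam μ₀ V (onSheet A u)) '' (onSheet A ⁻¹' (S ∩ feasible w V))) := by
  refine MeasurableSet.image_of_measurable_injOn
    (measurable_sigma_mk A (hS.inter measurableSet_feasible))
    (measurable_score.comp (measurable_sigma_mk A)) ?_
  exact (injOn_score hn hw hlam hβ hV).comp (onSheet_injective A).injOn fun _ hu => hu.2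

lemma measurable_augmented (hn : 0 < n) (hw : ∀ i, 0 < w i) (hlam : 0 < lam)
    (hβ : IsLassoEstimator X w lam βhat) (hV : IsSpectralMatrix X V Λ) :
    Measurable (augmented X w lam βhat) := by
  intro S hS
  rw [preimage_augmented (μ₀ := 0) hn hw hlam hβ hV S, image_eq_iUnion_sigma]
  exact measurable_noise (MeasurableSet.iUnion fun A =>
    measurableSet_image_score hn hw hlam hβ hV hS A)

end Measurability

/-! ### The Gaussian law of the noise coordinates -/

section NoiseLaw

open scoped NNReal

variable {n p : ℕ} {X : Matrix (Fin n) (Fin p) ℝ} {μ₀ : EuclideanSpace ℝ (Fin n)}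
  {V : Matrix (Fin p) (Fin n ⊕ Fin (p - n)) ℝ} {Λ : Fin n → ℝ}

lemma pi_gaussianReal_eq_withDensity {ι : Type*} [Fintype ι] (v : ι → ℝ≥0) (hv : ∀ j, v j ≠ 0) :
    Measure.pi (fun j => gaussianReal 0 (v j)) =
      (volume : Measure (ι → ℝ)).withDensity
        fun r => ENNReal.ofReal (∏ j, gaussianPDFReal 0 (v j) (r j)) := by
  -- Product measures are determined on boxes, where the integral of the product density factorizes.
  refine Measure.pi_eq fun s hs => ?_
  rw [withDensity_apply _ (MeasurableSet.univ_pi hs), volume_pi, Measure.restrict_pi_pi,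
    ← ofReal_integral_eq_lintegral_ofReal, integral_fintype_prod_eq_prod,
    ENNReal.ofReal_prod_of_nonneg]
  · exact Finset.prod_congr rfl fun j _ => (gaussianReal_apply_eq_integral 0 (hv j) _).symm
  · exact fun j _ => integral_nonneg fun x => gaussianPDFReal_nonneg _ _ _
  · exact Integrable.fintype_prod fun j => (integrable_gaussianPDFReal 0 (v j)).restrict
  · exact Filter.Eventually.of_forall fun r =>
      Finset.prod_nonneg fun j _ => gaussianPDFReal_nonneg _ _ _

lemma inner_noise (v t : EuclideanSpace ℝ (Fin n)) :
    inner ℝ (WithLp.toLp 2 (noise X μ₀ V v)) t =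
      inner ℝ v (WithLp.toLp 2 ((noiseMatrix X V)ᵀ *ᵥ t.ofLp)) -
        inner ℝ μ₀ (WithLp.toLp 2 ((noiseMatrix X V)ᵀ *ᵥ t.ofLp)) := by
  rw [← inner_sub_left]
  simp only [EuclideanSpace.inner_eq_star_dotProduct, star_trivial, noise, WithLp.ofLp_sub]
  rw [mulVec_transpose, dotProduct_mulVec]

/-- The noise coordinates are independent centred Gaussians with variances `σ² Λⱼ / n`. -/
lemma map_noise_multivariateGaussian (σ : ℝ) (hV : IsSpectralMatrix X V Λ) :
    (multivariateGaussian μ₀ (σ ^ 2 • (1 : Matrix (Fin n) (Fin n) ℝ))).map (noise X μ₀ V) =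
      Measure.pi fun j => gaussianReal 0 (σ ^ 2 * Λ j / (n : ℝ)).toNNReal := by
  have hS : (σ ^ 2 • (1 : Matrix (Fin n) (Fin n) ℝ)).PosSemidef :=
    PosSemidef.one.smul (sq_nonneg σ)
  have := Measure.isProbabilityMeasure_map (μ := multivariateGaussian μ₀
    (σ ^ 2 • (1 : Matrix (Fin n) (Fin n) ℝ)))
    (measurable_noise (X := X) (μ₀ := μ₀) (V := V)).aemeasurable
  -- Compare characteristic functions: the shift by μ₀ cancels the mean, and the quadratic form is
  -- diagonal in these coordinates.
  refine charFun_eq_pi_iff.1 fun t => ?_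
  set x := WithLp.toLp 2 ((noiseMatrix X V)ᵀ *ᵥ t.ofLp) with hx
  have hm : Measurable (WithLp.toLp 2 : (Fin n → ℝ) → EuclideanSpace ℝ (Fin n)) := by fun_prop
  rw [Measure.map_map hm measurable_noise, charFun_apply,
    integral_map (hm.comp measurable_noise).aemeasurable (by fun_prop)]
  have hexp : ∀ v : EuclideanSpace ℝ (Fin n),
      Complex.exp ((inner ℝ ((WithLp.toLp 2 ∘ noise X μ₀ V) v) t : ℝ) * Complex.I) =
        Complex.exp ((inner ℝ v x : ℝ) * Complex.I) *
          Complex.exp (-((inner ℝ μ₀ x : ℝ) * Complex.I)) := by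
    intro v
    rw [Function.comp_apply, inner_noise, ← Complex.exp_add]
    congr 1
    push_cast
    ring
  simp_rw [hexp]
  rw [integral_mul_const, ← charFun_apply, charFun_multivariateGaussian hS, ← Complex.exp_add]
  simp_rw [charFun_gaussianReal]
  rw [← Complex.exp_sum]
  congr 1
  have hquad : x.ofLp ⬝ᵥ ((σ ^ 2 • (1 : Matrix (Fin n) (Fin n) ℝ)) *ᵥ x.ofLp) =
      ∑ j, σ ^ 2 * Λ j / (n : ℝ) * t j ^ 2 := by
    rw [smul_mulVec, one_mulVec, dotProduct_smul, hx, dotProduct_mulVec, vecMul_transpose,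
      mulVec_mulVec, hV.noiseMatrix_mul_transpose, smul_mulVec, smul_dotProduct]
    simp only [dotProduct, mulVec_diagonal, smul_eq_mul, Finset.mul_sum]
    exact Finset.sum_congr rfl fun j _ => by ring
  rw [hquad, real_inner_comm]
  push_cast
  rw [Finset.sum_div]
  simp only [mul_zero, zero_mul, zero_sub, Finset.sum_neg_distrib]
  have hv : ∀ j, (((σ ^ 2 * Λ j / (n : ℝ)).toNNReal : ℝ) : ℂ) = (σ : ℂ) ^ 2 * Λ j / n := by
    intro j
    rw [Real.coe_toNNReal _ (by have := (hV.eigenvalues_pos j).le; positivity)]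
    push_cast
    rfl
  simp only [hv]
  ring

lemma map_noise_eq_withDensity_fR (hn : 0 < n) {σ : ℝ} (hσ : 0 < σ)
    (hV : IsSpectralMatrix X V Λ) :
    (multivariateGaussian μ₀ (σ ^ 2 • (1 : Matrix (Fin n) (Fin n) ℝ))).map (noise X μ₀ V) =
      (volume : Measure (Fin n → ℝ)).withDensity fun r => ENNReal.ofReal (fR σ Λ r) := by
  rw [map_noise_multivariateGaussian σ hV, pi_gaussianReal_eq_withDensity]
  · rfl
  · intro j
    have := hV.eigenvalues_pos j
    exact (Real.toNNReal_pos.2 (by positivity)).ne'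

lemma measurable_fR (σ : ℝ) (Λ : Fin n → ℝ) : Measurable (fR σ Λ) :=
  Finset.measurable_prod _ fun j _ =>
    (measurable_gaussianPDFReal _ _).comp (measurable_pi_apply j)

lemma fR_nonneg (σ : ℝ) (Λ : Fin n → ℝ) (r : Fin n → ℝ) : 0 ≤ fR σ Λ r :=
  Finset.prod_nonneg fun _ _ => gaussianPDFReal_nonneg _ _ _

end NoiseLaw

/-! ### Change of variables on one sheet -/

section ChangeOfVariables

variable {n p : ℕ} {X : Matrix (Fin n) (Fin p) ℝ} {w : Fin p → ℝ} {lam σ : ℝ}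
  {βhat : EuclideanSpace ℝ (Fin n) → Fin p → ℝ} {μ₀ : EuclideanSpace ℝ (Fin n)}
  {V : Matrix (Fin p) (Fin n ⊕ Fin (p - n)) ℝ} {Λ : Fin n → ℝ}
  {A : Finset (Fin p)}

/-- The parametrization `(b_A, s_F) ↦ (b_A, s₀ (sgn b_A) + B s_F)`. -/
noncomputable def sheetParam (B : Matrix {i // i ∉ A} (Fin (n - A.card)) ℝ)
    (s₀ : ({i // i ∈ A} → ℝ) → {i // i ∉ A} → ℝ)
    (u : ({i // i ∈ A} → ℝ) × (Fin (n - A.card) → ℝ)) :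
    ({i // i ∈ A} → ℝ) × ({i // i ∉ A} → ℝ) :=
  (u.1, s₀ (fun i => Real.sign (u.1 i)) + B *ᵥ u.2)

/-- Only finitely many sign vectors occur, so f may be arbitrary. This covers the choice of
particular solutions `s₀`, on which no regularity is imposed. -/
lemma measurable_comp_sign {ι β : Type*} [Finite ι] [MeasurableSpace β] (f : (ι → ℝ) → β) :
    Measurable fun b : ι → ℝ => f fun i => Real.sign (b i) := by
  have hfin : (Set.range fun (b : ι → ℝ) (i : ι) => Real.sign (b i)).Finite := by
    refine (Set.Finite.pi' (t := fun _ : ι => ({-1, 0, 1} : Set ℝ)) fun _ => by simp).subset ?_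
    rintro _ ⟨b, rfl⟩ i
    exact Real.sign_apply_eq (b i)
  have hs : Measurable fun (b : ι → ℝ) (i : ι) => Real.sign (b i) :=
    measurable_pi_lambda _ fun i => measurable_real_sign.comp (measurable_pi_apply i)
  intro S _
  have : (fun b : ι → ℝ => f fun i => Real.sign (b i)) ⁻¹' S =
      (fun (b : ι → ℝ) (i : ι) => Real.sign (b i)) ⁻¹'
        (f ⁻¹' S ∩ Set.range fun (b : ι → ℝ) (i : ι) => Real.sign (b i)) := by
    ext b
    simp
  rw [this]
  exact hs (hfin.subset Set.inter_subset_right).measurableSet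

lemma measurable_sheetParam (B : Matrix {i // i ∉ A} (Fin (n - A.card)) ℝ)
    (s₀ : ({i // i ∈ A} → ℝ) → {i // i ∉ A} → ℝ) : Measurable (sheetParam B s₀) :=
  measurable_fst.prodMk
    (((measurable_comp_sign s₀).comp measurable_fst).add ((measurable_mulVec B).comp measurable_snd))

lemma sheetParam_injective {B : Matrix {i // i ∉ A} (Fin (n - A.card)) ℝ}
    {s₀ : ({i // i ∈ A} → ℝ) → {i // i ∉ A} → ℝ} (hB : IsParametrization w V A B s₀) :
    Function.Injective (sheetParam B s₀) := by
  rintro ⟨b, f⟩ ⟨b', f'⟩ h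
  obtain ⟨rfl, h2⟩ := Prod.mk.inj h
  have h3 : B *ᵥ f = B *ᵥ f' := add_left_cancel h2
  rw [Matrix.mulVec_injective_iff.2 hB.linearIndependent h3]

lemma mem_range_sheetParam {B : Matrix {i // i ∉ A} (Fin (n - A.card)) ℝ}
    {s₀ : ({i // i ∈ A} → ℝ) → {i // i ∉ A} → ℝ} (hB : IsParametrization w V A B s₀)
    {u : ({i // i ∈ A} → ℝ) × ({i // i ∉ A} → ℝ)} (hu : onSheet A u ∈ feasible w V) :
    u ∈ Set.range (sheetParam B s₀) := by
  obtain ⟨hb, hc, -⟩ := hu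
  have hp := hB.particular (fun i => Real.sign (u.1 i))
    fun i => (Real.sign_apply_eq_of_ne_zero _ (hb i)).symm
  have hker : u.2 - s₀ (fun i => Real.sign (u.1 i)) ∈
      LinearMap.ker ((rowsOut A V.toCols₂)ᵀ * weightsOut A w).mulVecLin := by
    rw [LinearMap.mem_ker, mulVecLin_apply, mulVec_sub, sub_eq_zero]
    exact add_left_cancel (hc.trans hp.symm)
  rw [← hB.span_null, ← Matrix.range_mulVecLin] at hker
  obtain ⟨f, hf⟩ := hker
  refine ⟨(u.1, f), Prod.ext rfl ?_⟩
  rw [mulVecLin_apply] at hf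
  simp [sheetParam, hf]

/-- On a region where the signs of `b_A` are fixed, the score is affine with matrix `T`. -/
lemma score_sheetParam_sub (B : Matrix {i // i ∉ A} (Fin (n - A.card)) ℝ)
    (s₀ : ({i // i ∈ A} → ℝ) → {i // i ∉ A} → ℝ)
    {u u' : ({i // i ∈ A} → ℝ) × (Fin (n - A.card) → ℝ)}
    (h : ∀ i, Real.sign (u'.1 i) = Real.sign (u.1 i)) :
    score X w lam μ₀ V (onSheet A (sheetParam B s₀ u')) -
        score X w lam μ₀ V (onSheet A (sheetParam B s₀ u)) =
      T X w lam V A B *ᵥ Sum.elim (u'.1 - u.1) (u'.2 - u.2) := by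
  have hcoef : gram X *ᵥ
      (coefOf (onSheet A (sheetParam B s₀ u')) - coefOf (onSheet A (sheetParam B s₀ u))) =
        (gram X).submatrix id Subtype.val *ᵥ (u'.1 - u.1) := by
    ext k
    simp only [mulVec, dotProduct]
    rw [sum_eq_sum_mem_add_sum_notMem A, Fintype.sum_eq_zero (fun i : {i // i ∉ A} => _)
      fun i => by simp [coefOf, i.2], add_zero]
    exact Fintype.sum_congr _ _ fun i => by simp [coefOf, sheetParam]
  have hsub : V.toCols₁ᵀ *ᵥ (diagonal w *ᵥ
      (subgradOf (onSheet A (sheetParam B s₀ u')) - subgradOf (onSheet A (sheetParam B s₀ u)))) =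
        ((rowsOut A V.toCols₁)ᵀ * weightsOut A w * B) *ᵥ (u'.2 - u.2) := by
    simp only [weightsOut, ← mulVec_mulVec]
    ext k
    change ∑ i, V.toCols₁ i k * _ = ∑ i : {i // i ∉ A}, V.toCols₁ i.1 k * _
    simp only [mulVec_diagonal]
    rw [sum_eq_sum_mem_add_sum_notMem A, Fintype.sum_eq_zero (fun i : {i // i ∈ A} => _)
      fun i => by simp [subgradOf, sheetParam, h], zero_add]
    refine Fintype.sum_congr _ _ fun i => ?_
    simp [subgradOf, i.2, sheetParam, h, mulVec_sub]
  rw [score, score, ← mulVec_sub, T, fromCols_mulVec_sumElim, smul_mulVec, ← hsub,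
    ← mulVec_mulVec, ← hcoef, H, H, sub_sub_sub_cancel_right, add_sub_add_comm, ← mulVec_sub,
    ← smul_sub, ← mulVec_sub, mulVec_add, mulVec_smul]

/-- The coordinates `(b_A, s_F)` numbered as the columns of `T`. -/
noncomputable def coordEquiv (A : Finset (Fin p)) (hA : A.card ≤ n) :
    (Fin n → ℝ) ≃ᵐ ({i // i ∈ A} → ℝ) × (Fin (n - A.card) → ℝ) :=
  (MeasurableEquiv.piCongrLeft (fun _ => ℝ) (columnEquiv A hA)).trans
    (MeasurableEquiv.sumPiEquivProdPi fun _ => ℝ)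

lemma measurePreserving_coordEquiv (hA : A.card ≤ n) :
    MeasurePreserving (coordEquiv A hA) (volume : Measure (Fin n → ℝ))
      ((volume : Measure ({i // i ∈ A} → ℝ)).prod (volume : Measure (Fin (n - A.card) → ℝ))) :=
  (volume_measurePreserving_sumPiEquivProdPi _).comp (volume_measurePreserving_piCongrLeft _ _)

lemma coordEquiv_fst (hA : A.card ≤ n) (z : Fin n → ℝ) (i : {i // i ∈ A}) :
    (coordEquiv A hA z).1 i = z ((columnEquiv A hA).symm (Sum.inl i)) := by
  have h := Equiv.piCongrLeft_apply_apply (fun _ => ℝ) (columnEquiv A hA) z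
    ((columnEquiv A hA).symm (Sum.inl i))
  rwa [Equiv.apply_symm_apply] at h

lemma coordEquiv_snd (hA : A.card ≤ n) (z : Fin n → ℝ) (j : Fin (n - A.card)) :
    (coordEquiv A hA z).2 j = z ((columnEquiv A hA).symm (Sum.inr j)) := by
  have h := Equiv.piCongrLeft_apply_apply (fun _ => ℝ) (columnEquiv A hA) z
    ((columnEquiv A hA).symm (Sum.inr j))
  rwa [Equiv.apply_symm_apply] at h

lemma T_mulVec_coordEquiv_sub (hA : A.card ≤ n) (B : Matrix {i // i ∉ A} (Fin (n - A.card)) ℝ)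
    (z z' : Fin n → ℝ) :
    T X w lam V A B *ᵥ Sum.elim ((coordEquiv A hA z').1 - (coordEquiv A hA z).1)
        ((coordEquiv A hA z').2 - (coordEquiv A hA z).2) =
      (T X w lam V A B).submatrix id (columnEquiv A hA) *ᵥ (z' - z) := by
  rw [submatrix_mulVec_equiv, Function.comp_id]
  congr 1
  ext (i | j)
  · simp [coordEquiv_fst]
  · simp [coordEquiv_snd]

lemma eventually_sign_eq {b : ℝ} (hb : b ≠ 0) : ∀ᶠ b' in nhds b, Real.sign b' = Real.sign b := by
  rcases hb.lt_or_gt with hb | hb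
  · filter_upwards [Iio_mem_nhds hb] with b' hb'
    rw [Real.sign_of_neg hb, Real.sign_of_neg hb']
  · filter_upwards [Ioi_mem_nhds hb] with b' hb'
    rw [Real.sign_of_pos hb, Real.sign_of_pos hb']

/-- Nonzero entries of b_A keep their signs nearby, so the score agrees near z with an affine map.
-/
lemma hasFDerivAt_score (hA : A.card ≤ n) (B : Matrix {i // i ∉ A} (Fin (n - A.card)) ℝ)
    (s₀ : ({i // i ∈ A} → ℝ) → {i // i ∉ A} → ℝ) {z : Fin n → ℝ}
    (hz : ∀ i, (coordEquiv A hA z).1 i ≠ 0) :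
    HasFDerivAt (fun z => score X w lam μ₀ V (onSheet A (sheetParam B s₀ (coordEquiv A hA z))))
      (LinearMap.toContinuousLinearMap
        (toLin' ((T X w lam V A B).submatrix id (columnEquiv A hA)))) z := by
  set M := (T X w lam V A B).submatrix id (columnEquiv A hA) with hM
  have haff : HasFDerivAt (fun z' => LinearMap.toContinuousLinearMap (toLin' M) (z' - z) +
      score X w lam μ₀ V (onSheet A (sheetParam B s₀ (coordEquiv A hA z))))
      (LinearMap.toContinuousLinearMap (toLin' M)) z :=
    ((ContinuousLinearMap.hasFDerivAt _).comp z ((hasFDerivAt_id z).sub_const z)).add_const _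
  refine haff.congr_of_eventuallyEq ?_
  have hev : ∀ᶠ z' in nhds z, ∀ i, Real.sign ((coordEquiv A hA z').1 i) =
      Real.sign ((coordEquiv A hA z).1 i) := by
    refine Filter.eventually_all.2 fun i => ?_
    have hi := hz i
    simp only [coordEquiv_fst] at hi ⊢
    exact ((continuous_apply _).tendsto z).eventually (eventually_sign_eq hi)
  filter_upwards [hev] with z' hz'
  rw [LinearMap.coe_toContinuousLinearMap', toLin'_apply, hM, ← T_mulVec_coordEquiv_sub,
    ← score_sheetParam_sub (μ₀ := μ₀) B s₀ hz', sub_add_cancel]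

lemma measurable_density
    (B : ∀ A : Finset (Fin p), Matrix {i // i ∉ A} (Fin (n - A.card)) ℝ) :
    Measurable (density X w lam σ μ₀ V Λ B) := by
  refine ((measurable_fR σ Λ).comp measurable_score).mul ?_
  exact measurable_sigma_iff.2 fun A =>
    measurable_const (a := |detT X w lam V A (B A)|)

/-- Change of variables on one sheet of the augmented space. -/
lemma lintegral_image_score (hn : 0 < n) (hw : ∀ i, 0 < w i) (hlam : 0 < lam)
    (hβ : IsLassoEstimator X w lam βhat) (hV : IsSpectralMatrix X V Λ) (hA : A.card ≤ n)
    (B : ∀ A : Finset (Fin p), Matrix {i // i ∉ A} (Fin (n - A.card)) ℝ)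
    {s₀ : ({i // i ∈ A} → ℝ) → {i // i ∉ A} → ℝ} (hB : IsParametrization w V A (B A) s₀)
    {S : Set (({i // i ∈ A} → ℝ) × ({i // i ∉ A} → ℝ))} (hS : MeasurableSet S)
    (hSf : S ⊆ onSheet A ⁻¹' feasible w V) :
    ∫⁻ r in (fun u => score X w lam μ₀ V (onSheet A u)) '' S, ENNReal.ofReal (fR σ Λ r) =
      ∫⁻ u in S, ENNReal.ofReal (density X w lam σ μ₀ V Λ B (onSheet A u))
        ∂thetaMeasure A (B A) s₀ := by
  set D := coordEquiv A hA ⁻¹' (sheetParam (B A) s₀ ⁻¹' S) with hD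
  have hpm := measurable_sheetParam (B A) s₀
  have hDm : MeasurableSet D := (coordEquiv A hA).measurable (hpm hS)
  have himage : (fun u => score X w lam μ₀ V (onSheet A u)) '' S =
      (fun z => score X w lam μ₀ V (onSheet A (sheetParam (B A) s₀ (coordEquiv A hA z)))) '' D := by
    ext r
    constructor
    · rintro ⟨u, hu, rfl⟩
      obtain ⟨t, rfl⟩ := mem_range_sheetParam hB (hSf hu)
      exact ⟨(coordEquiv A hA).symm t, by simpa [hD] using hu, by simp⟩
    · rintro ⟨z, hz, rfl⟩
      exact ⟨_, hz, rfl⟩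
  have hinj : Set.InjOn
      (fun z => score X w lam μ₀ V (onSheet A (sheetParam (B A) s₀ (coordEquiv A hA z)))) D := by
    intro z hz z' hz' h
    have := injOn_score hn hw hlam hβ hV (hSf hz) (hSf hz') h
    exact (coordEquiv A hA).injective (sheetParam_injective hB (onSheet_injective A this))
  have hdens : Measurable fun u => ENNReal.ofReal (density X w lam σ μ₀ V Λ B (onSheet A u)) :=
    ((measurable_density B).comp (measurable_sigma_mk A)).ennreal_ofReal
  -- The formula asks only for injectivity and a derivative on D, so invertibility of T need not be
  -- shown.
  rw [himage, lintegral_image_eq_lintegral_abs_det_fderiv_mul volume hDm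
    (fun z hz => (hasFDerivAt_score hA (B A) s₀ (hSf hz).1).hasFDerivWithinAt) hinj]
  change _ = ∫⁻ u in S, _ ∂(Measure.map (sheetParam (B A) s₀) _)
  rw [setLIntegral_map hS hdens hpm]
  refine Eq.trans ?_ ((measurePreserving_coordEquiv hA).setLIntegral_comp_preimage
    (hpm hS) (hdens.comp hpm))
  refine lintegral_congr fun z => ?_
  rw [LinearMap.det_toContinuousLinearMap, LinearMap.det_toLin', mul_comm,
    ← ENNReal.ofReal_mul (fR_nonneg _ _ _)]
  simp [density, detT, hA, score]

end ChangeOfVariables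

/-! ### Assembling the sheets into the law of the estimator -/

section Law

variable {n p : ℕ} {X : Matrix (Fin n) (Fin p) ℝ} {w : Fin p → ℝ} {lam σ : ℝ}
  {βhat : EuclideanSpace ℝ (Fin n) → Fin p → ℝ} {μ₀ : EuclideanSpace ℝ (Fin n)}
  {V : Matrix (Fin p) (Fin n ⊕ Fin (p - n)) ℝ} {Λ : Fin n → ℝ}
  {B : ∀ A : Finset (Fin p), Matrix {i // i ∉ A} (Fin (n - A.card)) ℝ}
  {s₀ : ∀ A : Finset (Fin p), ({i // i ∈ A} → ℝ) → {i // i ∉ A} → ℝ}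

lemma setLIntegral_refMeasure {S : Set (AugSpace p)} (hS : MeasurableSet S) {f : AugSpace p → ℝ≥0∞}
    (hf : Measurable f) :
    ∫⁻ x in S, f x ∂refMeasure w V B s₀ =
      ∑ A : Finset (Fin p) with A.card ≤ n,
        ∫⁻ u in onSheet A ⁻¹' (S ∩ feasible w V), f (onSheet A u) ∂thetaMeasure A (B A) (s₀ A) := by
  rw [refMeasure, Measure.restrict_restrict hS, ← Measure.restrictₗ_apply, map_sum,
    lintegral_finsetSum_measure]
  exact Finset.sum_congr rfl fun A _ =>
    setLIntegral_map (hS.inter measurableSet_feasible) hf (measurable_sigma_mk A)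

/-- The augmented estimator has density `f_R(V_Rᵀ H) |det T|` with respect to the reference
measure. -/
lemma map_augmented_multivariateGaussian (hn : 0 < n) (hw : ∀ i, 0 < w i) (hlam : 0 < lam)
    (hσ : 0 < σ) (hβ : IsLassoEstimator X w lam βhat) (hV : IsSpectralMatrix X V Λ)
    (hB : ∀ A : Finset (Fin p), A.card ≤ n → IsParametrization w V A (B A) (s₀ A)) :
    (multivariateGaussian μ₀ (σ ^ 2 • (1 : Matrix (Fin n) (Fin n) ℝ))).map
        (augmented X w lam βhat) =
      (refMeasure w V B s₀).withDensity
        fun x => ENNReal.ofReal (density X w lam σ μ₀ V Λ B x) := by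
  ext S hS
  have himage : score X w lam μ₀ V '' (S ∩ feasible w V) =
      ⋃ A ∈ Finset.univ.filter fun A : Finset (Fin p) => A.card ≤ n,
        (fun u => score X w lam μ₀ V (onSheet A u)) '' (onSheet A ⁻¹' (S ∩ feasible w V)) := by
    ext r
    simp only [Set.mem_iUnion, Finset.mem_filter, Finset.mem_univ, true_and]
    constructor
    · rintro ⟨x, hx, rfl⟩
      exact ⟨x.1, card_le_of_mem_feasible hn hw hlam hβ hV hx.2, x.2, hx, rfl⟩
    · rintro ⟨A, -, u, hu, rfl⟩
      exact ⟨_, hu, rfl⟩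
  have hmeas : ∀ A : Finset (Fin p), MeasurableSet
      ((fun u => score X w lam μ₀ V (onSheet A u)) '' (onSheet A ⁻¹' (S ∩ feasible w V))) :=
    fun A => measurableSet_image_score hn hw hlam hβ hV hS A
  have hmeas' : MeasurableSet (score X w lam μ₀ V '' (S ∩ feasible w V)) := by
    rw [himage]
    exact Finset.measurableSet_biUnion _ fun A _ => hmeas A
  rw [Measure.map_apply (measurable_augmented hn hw hlam hβ hV) hS,
    preimage_augmented (μ₀ := μ₀) hn hw hlam hβ hV, ← Measure.map_apply measurable_noise hmeas',
    map_noise_eq_withDensity_fR hn hσ hV, withDensity_apply _ hS,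
    setLIntegral_refMeasure hS (measurable_density B).ennreal_ofReal, himage,
    measure_biUnion_finset _ fun A _ => hmeas A]
  · refine Finset.sum_congr rfl fun A hA => ?_
    have hcard := (Finset.mem_filter.1 hA).2
    rw [withDensity_apply _ (hmeas A)]
    exact lintegral_image_score hn hw hlam hβ hV hcard B (hB A hcard)
      (measurable_sigma_mk A (hS.inter measurableSet_feasible)) fun u hu => hu.2
  -- A score shared by two sheets would come from a single feasible point, hence a single active
  -- set.
  · intro A _ A' _ hne
    refine Set.disjoint_left.2 ?_
    rintro _ ⟨u, hu, rfl⟩ ⟨u', hu', h⟩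
    exact hne (congrArg Sigma.fst (injOn_score hn hw hlam hβ hV hu'.2 hu.2 h)).symm

end Law

/-- The law of a variable conditioned on an event about it, through an unnormalized density. -/
lemma map_cond_eq_withDensity {Ω α : Type*} [MeasurableSpace Ω] [MeasurableSpace α]
    {P : Measure Ω} [IsProbabilityMeasure P] {Y : Ω → α} (hY : Measurable Y) {ν : Measure α}
    {g : α → ℝ≥0∞} (hg : Measurable g) (hlaw : P.map Y = ν.withDensity g) {S : Set α}
    (hS : MeasurableSet S) (hpos : P (Y ⁻¹' S) ≠ 0) :
    (∫⁻ x, S.indicator g x ∂ν) ≠ 0 ∧ (∫⁻ x, S.indicator g x ∂ν) ≠ ∞ ∧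
      (P[|Y ⁻¹' S]).map Y =
        ν.withDensity fun x => (∫⁻ x, S.indicator g x ∂ν)⁻¹ * S.indicator g x := by
  -- The normalizing constant is the probability of the conditioning event, so it is finite and
  -- nonzero.
  have hZ : ∫⁻ x, S.indicator g x ∂ν = P (Y ⁻¹' S) := by
    rw [lintegral_indicator hS, ← withDensity_apply _ hS, ← hlaw, Measure.map_apply hY hS]
  rw [hZ]
  refine ⟨hpos, measure_ne_top _ _, ?_⟩
  change _ = ν.withDensity ((P (Y ⁻¹' S))⁻¹ • S.indicator g)
  rw [withDensity_smul _ (hg.indicator hS), withDensity_indicator hS, ← restrict_withDensity hS,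
    ← hlaw, Measure.restrict_map hY hS, ProbabilityTheory.cond, Measure.map_smul]

end LassoEA

theorem corollary2 {n p : ℕ} (hn : 0 < n) (hnp : n < p)
    (X : Matrix (Fin n) (Fin p) ℝ)
    (hX : ∀ C : Finset (Fin p), C.card = n → LinearIndependent ℝ (fun j : {i // i ∈ C} => X.col j))
    (w : Fin p → ℝ) (hw : ∀ i, 0 < w i) (lam : ℝ) (hlam : 0 < lam)
    (σ : ℝ) (hσ : 0 < σ) (μ₀ : EuclideanSpace ℝ (Fin n))
    {Ω : Type*} [MeasurableSpace Ω] (P : Measure Ω) [IsProbabilityMeasure P]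
    (y : Ω → EuclideanSpace ℝ (Fin n)) (hy : Measurable y)
    (hylaw : HasLaw y (multivariateGaussian μ₀ (σ ^ 2 • (1 : Matrix (Fin n) (Fin n) ℝ))) P)
    (βhat : EuclideanSpace ℝ (Fin n) → Fin p → ℝ)
    (hβ : LassoEA.IsLassoEstimator X w lam βhat)
    (V : Matrix (Fin p) (Fin n ⊕ Fin (p - n)) ℝ) (Λ : Fin n → ℝ)
    (hV : LassoEA.IsSpectralMatrix X V Λ)
    (B : ∀ A : Finset (Fin p), Matrix {i // i ∉ A} (Fin (n - A.card)) ℝ)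
    (s₀ : ∀ A : Finset (Fin p), ({i // i ∈ A} → ℝ) → {i // i ∉ A} → ℝ)
    (hB : ∀ A : Finset (Fin p), A.card ≤ n → LassoEA.IsParametrization w V A (B A) (s₀ A))
    {γ : Type*} (F : LassoEA.AugSpace p → γ) (E : Set γ) (hFE : MeasurableSet (F ⁻¹' E))
    (hpos : P {ω | F (LassoEA.augmented X w lam βhat (y ω)) ∈ E} ≠ 0) :
    (∀ v, LassoEA.IsL1Subgradient (βhat v) (LassoEA.kktSubgradient X w lam v (βhat v))) ∧
    Measurable (LassoEA.augmented X w lam βhat) ∧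
    ∃ Z : ℝ≥0∞,
      Z = ∫⁻ x, LassoEA.selectedDensity X w lam σ μ₀ V Λ B F E x ∂LassoEA.refMeasure w V B s₀ ∧
      Z ≠ 0 ∧ Z ≠ ∞ ∧
      (P[|{ω | F (LassoEA.augmented X w lam βhat (y ω)) ∈ E}]).map
          (fun ω => LassoEA.augmented X w lam βhat (y ω)) =
        (LassoEA.refMeasure w V B s₀).withDensity
          (fun x => Z⁻¹ * LassoEA.selectedDensity X w lam σ μ₀ V Λ B F E x) := by
  have hmeas := LassoEA.measurable_augmented hn hw hlam hβ hV
  have hlaw : P.map (fun ω => LassoEA.augmented X w lam βhat (y ω)) =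
      (LassoEA.refMeasure w V B s₀).withDensity
        fun x => ENNReal.ofReal (LassoEA.density X w lam σ μ₀ V Λ B x) := by
    rw [← LassoEA.map_augmented_multivariateGaussian hn hw hlam hσ hβ hV hB, ← hylaw.map_eq,
      Measure.map_map hmeas hy]
    rfl
  exact ⟨fun v => LassoEA.isL1Subgradient_of_isMinOn hn hw hlam (hβ v).1, hmeas, _, rfl,
    LassoEA.map_cond_eq_withDensity (hmeas.comp hy)
      (LassoEA.measurable_density B).ennreal_ofReal hlaw hFE hpos⟩
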